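/- Let $G$ be a group of permutations of a set $E$. For $n \in \mathbb{N}$ let $\varphi_G(n)$ be the number of $G$-orbits of subsets of $E$ of size $n$. The group $G$ is called oligomorphic if $\varphi_G(n)$ is finite for every $n$, and $P$-oligomorphic if $\varphi_G$ is bounded by a polynomial in $n$. A block system of $G$ is a partition of $E$ into (nonempty) parts, called blocks, such that each $g \in G$ maps blocks onto blocks. The block systems of $G$, ordered by refinement (finer systems being smaller), form a sublattice $\mathcal{L}(G)$ of the lattice of set partitions of $E$. Let $G$ be oligomorphic, and let $\mathcal{L}^{<\infty}(G)$ be the set of all block systems of $G$ whose blocks are all finite. Then $\mathcal{L}^{<\infty}(G)$ is a sublattice of $\mathcal{L}(G)$ (it is closed under the joins and meets of $\mathcal{L}(G)$), and its minimum is the trivial block system $\{\{e\} \mid e \in E\}$. If, in addition, $G$ is $P$-oligomorphic, then $\mathcal{L}^{<\infty}(G)$ is finite and has a maximum $\mathcal{B}^{<\infty}$. -/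

import Mathlib

open scoped Pointwise

namespace PermGroup

variable {E : Type*}

/-- The degree `n` part of the age of `G`: the set of `G`-orbits of subsets of `E` of size `n`. -/
def age (G : Subgroup (Equiv.Perm E)) (n : ℕ) : Set (Set (Set E)) :=
  {O | ∃ A : Finset E, A.card = n ∧ O = MulAction.orbit G (A : Set E)}

/-- The profile of `G`: the number (possibly infinite) of orbits of subsets of size `n`. -/
noncomputable def profile (G : Subgroup (Equiv.Perm E)) (n : ℕ) : ℕ∞ :=
  (age G n).encard

/-- `G` is oligomorphic if its profile takes only finite values. -/
def IsOligomorphic (G : Subgroup (Equiv.Perm E)) : Prop :=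
  ∀ n : ℕ, profile G n ≠ ⊤

/-- `G` is `P`-oligomorphic if its profile is bounded by a polynomial
(in particular all the values of the profile are finite). -/
def IsPOligomorphic (G : Subgroup (Equiv.Perm E)) : Prop :=
  ∃ p : Polynomial ℝ, ∀ n : ℕ, ∃ k : ℕ, profile G n = (k : ℕ∞) ∧ (k : ℝ) ≤ p.eval (n : ℝ)

/-- A block system of `G`: a partition of `E` such that each `g ∈ G` maps blocks onto blocks.
(`MulAction.IsBlockSystem` only asks each part to be a block, which is weaker when `G` is
not transitive.) -/
def IsBlockSystem (G : Subgroup (Equiv.Perm E)) (P : Setoid.Partitions E) : Prop :=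
  ∀ g ∈ G, ∀ B ∈ P.toSet, g '' B ∈ P.toSet

/-- Partitions as equivalence relations, for the refinement order. -/
lemma orderIso_symm_apply (P : Setoid.Partitions E) :
    (Setoid.Partition.orderIso E).symm P = Setoid.mkClasses P.toSet P.isPartition.2 := rfl

lemma rel_iff (P : Setoid.Partitions E) (x y : E) :
    (Setoid.Partition.orderIso E).symm P x y ↔ ∃ B ∈ P.toSet, x ∈ B ∧ y ∈ B := by
  rw [orderIso_symm_apply]
  constructor
  · intro h
    obtain ⟨B, ⟨hB, hx⟩, -⟩ := P.isPartition.2 x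
    exact ⟨B, hB, hx, h B hB hx⟩
  · rintro ⟨B, hB, hx, hy⟩ C hC hxC
    rwa [← Setoid.eq_of_mem_eqv_class P.isPartition.2 hB hx hC hxC]

/-- A partition is a block system iff its equivalence relation is invariant under `G`. -/
lemma isBlockSystem_iff (G : Subgroup (Equiv.Perm E)) (P : Setoid.Partitions E) :
    IsBlockSystem G P ↔ ∀ g ∈ G, ∀ x y,
      (Setoid.Partition.orderIso E).symm P x y →
        (Setoid.Partition.orderIso E).symm P (g x) (g y) := by
  constructor
  · intro h g hg x y hxy
    obtain ⟨B, hB, hx, hy⟩ := (rel_iff P x y).1 hxy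
    exact (rel_iff P _ _).2
      ⟨g '' B, h g hg B hB, Set.mem_image_of_mem g hx, Set.mem_image_of_mem g hy⟩
  · intro h g hg B hB
    obtain ⟨x, hx⟩ := Setoid.nonempty_of_mem_partition P.isPartition hB
    obtain ⟨C, ⟨hC, hgx⟩, -⟩ := P.isPartition.2 (g x)
    have key : g '' B = C := by
      ext z
      constructor
      · rintro ⟨y, hy, rfl⟩
        obtain ⟨D, hD, h1, h2⟩ := (rel_iff P _ _).1 (h g hg x y ((rel_iff P x y).2 ⟨B, hB, hx, hy⟩))
        rwa [Setoid.eq_of_mem_eqv_class P.isPartition.2 hC hgx hD h1]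
      · intro hz
        have := h g⁻¹ (G.inv_mem hg) _ _ ((rel_iff P (g x) z).2 ⟨C, hC, hgx, hz⟩)
        obtain ⟨D, hD, h1, h2⟩ := (rel_iff P _ _).1 this
        rw [← Equiv.Perm.mul_apply, inv_mul_cancel, Equiv.Perm.one_apply] at h1
        rw [Setoid.eq_of_mem_eqv_class P.isPartition.2 hD h1 hB hx] at h2
        exact ⟨g⁻¹ z, h2, by simp⟩
    rwa [key]

/-- The lattice of all block systems of `G`, as a sublattice of the lattice of set partitions
of `E`, ordered by refinement (`P ≤ Q` if `P` is finer than `Q`). -/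
def blockLattice (G : Subgroup (Equiv.Perm E)) : Sublattice (Setoid.Partitions E) where
  carrier := {P | IsBlockSystem G P}
  supClosed' := by
    intro P hP Q hQ
    simp only [Set.mem_ofPred_eq, isBlockSystem_iff] at hP hQ ⊢
    intro g hg
    have hle : (Setoid.Partition.orderIso E).symm (P ⊔ Q) ≤
        Setoid.comap g ((Setoid.Partition.orderIso E).symm (P ⊔ Q)) := by
      rw [OrderIso.map_sup]
      refine sup_le ?_ ?_
      · intro x y hxy
        exact (le_sup_left : (Setoid.Partition.orderIso E).symm P ≤ _) (hP g hg x y hxy)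
      · intro x y hxy
        exact (le_sup_right : (Setoid.Partition.orderIso E).symm Q ≤ _) (hQ g hg x y hxy)
    exact fun x y hxy => hle hxy
  infClosed' := by
    intro P hP Q hQ
    simp only [Set.mem_ofPred_eq, isBlockSystem_iff] at hP hQ ⊢
    intro g hg x y hxy
    rw [OrderIso.map_inf] at hxy ⊢
    exact ⟨hP g hg x y hxy.1, hQ g hg x y hxy.2⟩

/-- The trivial block system `{{e} | e ∈ E}`. -/
def trivialSystem (G : Subgroup (Equiv.Perm E)) : blockLattice G :=
  ⟨⟨Set.range fun e : E => ({e} : Set E), by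
      refine ⟨by simp, fun a => ⟨{a}, by simp, ?_⟩⟩
      rintro B ⟨⟨e, rfl⟩, ha⟩
      simp only [Set.mem_singleton_iff] at ha
      simp [ha]⟩, by
    rintro g - B ⟨e, rfl⟩
    exact ⟨g e, by simp⟩⟩

/-- The block systems of `G` all of whose blocks are finite. -/
def finiteBlockSystems (G : Subgroup (Equiv.Perm E)) : Set (blockLattice G) :=
  {P | ∀ B ∈ P.1.toSet, B.Finite}

end PermGroup

/-!
The argument is the model-theoretic one, with algebraic closure. If `G` is oligomorphic, it has
finitely many orbits on `E × E` (`IsOligomorphic.exists_finite_pairs`). Two consequences carry the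
theorem.

* An invariant equivalence relation is a union of orbits of pairs, so there are only finitely many
  block systems (`IsOligomorphic.finite_blockLattice`).
* Call `y` algebraic over `x` if the stabilizer of `x` moves `y` to finitely many points only. This
  relation is reflexive and transitive, and the points algebraic over a given `x` form a finite set,
  since the stabilizer of `x` has finitely many orbits (`IsOligomorphic.finite_algebraicOver`). In a
  block system with finite blocks, points of the same block are algebraic over each other, because
  the stabilizer of `x` preserves the block of `x`. By transitivity this passes to the join of two
  such systems, whose blocks are therefore finite.

The maximum is then the join of the finitely many block systems with finite blocks.
-/

namespace PermGroup

/-- A point `y` is algebraic over `x` if its orbit under the stabilizer of `x` in `G` is finite. -/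
def AlgebraicOver {E : Type*} (G : Subgroup (Equiv.Perm E)) (x y : E) : Prop :=
  {z | ∃ g ∈ G, g x = x ∧ g y = z}.Finite

lemma AlgebraicOver.refl {E : Type*} (G : Subgroup (Equiv.Perm E)) (x : E) :
    AlgebraicOver G x x := by
  refine (Set.finite_singleton x).subset ?_
  rintro z ⟨g, -, h1, h2⟩
  exact h2.symm.trans h1

lemma AlgebraicOver.trans {E : Type*} {G : Subgroup (Equiv.Perm E)} {x y z : E}
    (hxy : AlgebraicOver G x y) (hyz : AlgebraicOver G y z) : AlgebraicOver G x z := by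
  -- For each of the finitely many images `y'` of `y`, the possible images of `z` lie in the
  -- translate, by any group element taking `y` to `y'`, of the orbit of `z` over `y`.
  have key : ∀ y' ∈ {y' | ∃ g ∈ G, g x = x ∧ g y = y'},
      {z' | ∃ g ∈ G, g y = y' ∧ g z = z'}.Finite := by
    rintro y' ⟨h, hh, -, hy⟩
    refine (Set.Finite.image h hyz).subset ?_
    rintro z' ⟨g, hg, h1, h2⟩
    refine ⟨h⁻¹ (g z), ⟨h⁻¹ * g, G.mul_mem (G.inv_mem hh) hg, ?_, rfl⟩, ?_⟩
    · rw [Equiv.Perm.mul_apply, h1, ← hy, Equiv.Perm.inv_def, Equiv.symm_apply_apply]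
    · rw [Equiv.Perm.inv_def, Equiv.apply_symm_apply, h2]
  refine (Set.Finite.biUnion hxy key).subset ?_
  rintro z' ⟨g, hg, h1, h2⟩
  exact Set.mem_biUnion (show g y ∈ _ from ⟨g, hg, h1, rfl⟩) ⟨g, hg, rfl, h2⟩

/-- An oligomorphic group has finitely many orbits of pairs: some finite set of pairs meets every
orbit. -/
lemma IsOligomorphic.exists_finite_pairs {E : Type*} {G : Subgroup (Equiv.Perm E)}
    (hG : IsOligomorphic G) :
    ∃ F : Set (E × E), F.Finite ∧ ∀ x y, ∃ g ∈ G, (g x, g y) ∈ F := by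
  classical
  have hfin : ∀ n, (age G n).Finite := fun n => Set.encard_ne_top_iff.1 (hG n)
  have hrep : ∀ O ∈ age G 1 ∪ age G 2, ∃ A : Finset E, O = MulAction.orbit G (A : Set E) := by
    rintro O (⟨A, -, hA⟩ | ⟨A, -, hA⟩) <;> exact ⟨A, hA⟩
  choose! A hA using hrep
  refine ⟨⋃ O ∈ age G 1 ∪ age G 2, (A O : Set E) ×ˢ (A O : Set E),
    ((hfin 1).union (hfin 2)).biUnion fun O _ => (A O).finite_toSet.prod (A O).finite_toSet,
    fun x y => ?_⟩
  have hO : MulAction.orbit G (({x, y} : Finset E) : Set E) ∈ age G 1 ∪ age G 2 := by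
    by_cases hxy : x = y
    · exact Or.inl ⟨{x, y}, by simp [hxy], rfl⟩
    · exact Or.inr ⟨{x, y}, Finset.card_pair hxy, rfl⟩
  obtain ⟨g, hg⟩ := MulAction.orbit_eq_iff.1 (hA _ hO).symm
  have hmem : ∀ z ∈ ({x, y} : Finset E),
      (g : Equiv.Perm E) z ∈ (A (MulAction.orbit G (({x, y} : Finset E) : Set E)) : Set E) := by
    intro z hz
    rw [← hg]
    exact Set.smul_mem_smul_set (a := g) (Finset.mem_coe.2 hz)
  exact ⟨g, g.2, Set.mem_biUnion hO ⟨hmem x (by simp), hmem y (by simp)⟩⟩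

lemma IsOligomorphic.finite_algebraicOver {E : Type*} {G : Subgroup (Equiv.Perm E)}
    (hG : IsOligomorphic G) (x : E) : {y | AlgebraicOver G x y}.Finite := by
  obtain ⟨F, hF, hmem⟩ := hG.exists_finite_pairs
  have key : ∀ p ∈ F, {y | AlgebraicOver G x y ∧ ∃ g ∈ G, (g x, g y) = p}.Finite := by
    intro p _
    -- The points `y` for which `(x, y)` is a translate of `p` form a single orbit over `x`.
    obtain h | ⟨y₀, hy₀, g₀, hg₀, h₀⟩ :=
      Set.eq_empty_or_nonempty {y | AlgebraicOver G x y ∧ ∃ g ∈ G, (g x, g y) = p}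
    · rw [h]
      exact Set.finite_empty
    · refine Set.Finite.subset hy₀ ?_
      rintro y ⟨-, g, hg, hp⟩
      obtain ⟨h1, h2⟩ := Prod.mk.inj (hp.trans h₀.symm)
      refine ⟨g⁻¹ * g₀, G.mul_mem (G.inv_mem hg) hg₀, ?_, ?_⟩
      · rw [Equiv.Perm.mul_apply, ← h1, Equiv.Perm.inv_def, Equiv.symm_apply_apply]
      · rw [Equiv.Perm.mul_apply, ← h2, Equiv.Perm.inv_def, Equiv.symm_apply_apply]
  refine (hF.biUnion key).subset fun y hy => ?_
  obtain ⟨g, hg, hp⟩ := hmem x y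
  exact Set.mem_biUnion hp ⟨hy, g, hg, rfl⟩

/-- An oligomorphic group has finitely many block systems: each is determined by the
representatives of orbits of pairs that its equivalence relation contains. -/
lemma IsOligomorphic.finite_blockLattice {E : Type*} {G : Subgroup (Equiv.Perm E)}
    (hG : IsOligomorphic G) : Finite (blockLattice G) := by
  obtain ⟨F, hF, hmem⟩ := hG.exists_finite_pairs
  let r (P : blockLattice G) : Setoid E := (Setoid.Partition.orderIso E).symm P.1
  have hr : ∀ (P : blockLattice G), ∀ g ∈ G, ∀ x y, r P (g x) (g y) ↔ r P x y := by
    refine fun P g hg x y => ⟨fun h => ?_, (isBlockSystem_iff G P.1).1 P.2 g hg x y⟩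
    simpa using (isBlockSystem_iff G P.1).1 P.2 g⁻¹ (G.inv_mem hg) _ _ h
  have : Finite (Set.powerset F) := hF.finite_subsets
  let f (P : blockLattice G) : Set.powerset F := ⟨{p ∈ F | r P p.1 p.2}, fun _ h => h.1⟩
  refine Finite.of_injective f fun P Q hPQ => ?_
  have hrel : r P = r Q := by
    ext x y
    obtain ⟨g, hg, hp⟩ := hmem x y
    have := Set.ext_iff.1 (congrArg Subtype.val hPQ) (g x, g y)
    simpa [f, hp, hr _ g hg] using this
  exact Subtype.ext ((Setoid.Partition.orderIso E).symm.injective hrel)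

lemma mem_finiteBlockSystems_iff {E : Type*} {G : Subgroup (Equiv.Perm E)} (P : blockLattice G) :
    P ∈ finiteBlockSystems G ↔
      ∀ x, {y | (Setoid.Partition.orderIso E).symm P.1 x y}.Finite := by
  constructor
  · intro h x
    obtain ⟨B, ⟨hB, hx⟩, -⟩ := P.1.isPartition.2 x
    refine (h B hB).subset fun y hy => ?_
    obtain ⟨C, hC, hxC, hyC⟩ := (rel_iff _ _ _).1 hy
    rwa [Setoid.eq_of_mem_eqv_class P.1.isPartition.2 hB hx hC hxC]
  · intro h B hB
    obtain ⟨x, hx⟩ := Setoid.nonempty_of_mem_partition P.1.isPartition hB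
    exact (h x).subset fun y hy => (rel_iff _ _ _).2 ⟨B, hB, hx, hy⟩

lemma algebraicOver_of_rel {E : Type*} {G : Subgroup (Equiv.Perm E)} {P : blockLattice G}
    (hP : P ∈ finiteBlockSystems G) {x y : E}
    (h : (Setoid.Partition.orderIso E).symm P.1 x y) : AlgebraicOver G x y := by
  refine ((mem_finiteBlockSystems_iff P).1 hP x).subset ?_
  rintro z ⟨g, hg, hx, rfl⟩
  have := (isBlockSystem_iff G P.1).1 P.2 g hg x y h
  rwa [hx] at this

lemma IsOligomorphic.supClosed_finiteBlockSystems {E : Type*} {G : Subgroup (Equiv.Perm E)}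
    (hG : IsOligomorphic G) : SupClosed (finiteBlockSystems G) := by
  intro P hP Q hQ
  rw [mem_finiteBlockSystems_iff]
  refine fun x => (hG.finite_algebraicOver x).subset fun y hy => ?_
  rw [Set.mem_ofPred_eq, Sublattice.coe_sup, OrderIso.map_sup, Setoid.sup_eq_eqvGen] at hy
  -- Being algebraic is not symmetric, so the induction carries both directions.
  have both : AlgebraicOver G x y ∧ AlgebraicOver G y x := by
    induction hy with
    | rel a b h =>
      rcases h with h | h
      · exact ⟨algebraicOver_of_rel hP h, algebraicOver_of_rel hP (Setoid.symm' _ h)⟩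
      · exact ⟨algebraicOver_of_rel hQ h, algebraicOver_of_rel hQ (Setoid.symm' _ h)⟩
    | refl a => exact ⟨.refl G a, .refl G a⟩
    | symm a b _ ih => exact ih.symm
    | trans a b c _ _ ih1 ih2 => exact ⟨ih1.1.trans ih2.1, ih2.2.trans ih1.2⟩
  exact both.1

lemma infClosed_finiteBlockSystems {E : Type*} (G : Subgroup (Equiv.Perm E)) :
    InfClosed (finiteBlockSystems G) := by
  intro P hP Q _
  rw [mem_finiteBlockSystems_iff] at hP ⊢
  refine fun x => (hP x).subset fun y hy => ?_
  rw [Set.mem_ofPred_eq, Sublattice.coe_inf, OrderIso.map_inf] at hy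
  exact hy.1

lemma isLeast_trivialSystem {E : Type*} (G : Subgroup (Equiv.Perm E)) :
    IsLeast (finiteBlockSystems G) (trivialSystem G) := by
  constructor
  · rintro B ⟨e, rfl⟩
    exact Set.finite_singleton e
  · intro P _
    refine (Setoid.Partition.orderIso E).symm.le_iff_le.1 fun x y h => ?_
    obtain ⟨B, ⟨e, rfl⟩, hx, hy⟩ := (rel_iff (trivialSystem G).1 x y).1 h
    rw [Set.mem_singleton_iff.1 hx, Set.mem_singleton_iff.1 hy]

end PermGroup

theorem mainTheorem11 {E : Type*} (G : Subgroup (Equiv.Perm E))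
    (hG : PermGroup.IsOligomorphic G) :
    IsSublattice (PermGroup.finiteBlockSystems G) ∧
    IsLeast (PermGroup.finiteBlockSystems G) (PermGroup.trivialSystem G) ∧
    (PermGroup.IsPOligomorphic G →
      (PermGroup.finiteBlockSystems G).Finite ∧
      ∃ M : PermGroup.blockLattice G, IsGreatest (PermGroup.finiteBlockSystems G) M) := by
  have hleast := PermGroup.isLeast_trivialSystem G
  have hsup := hG.supClosed_finiteBlockSystems
  refine ⟨⟨hsup, PermGroup.infClosed_finiteBlockSystems G⟩, hleast, fun _ => ?_⟩
  have := hG.finite_blockLattice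
  have hfin := Set.toFinite (PermGroup.finiteBlockSystems G)
  have hne : hfin.toFinset.Nonempty := ⟨_, hfin.mem_toFinset.2 hleast.1⟩
  exact ⟨hfin, hfin.toFinset.sup' hne id,
    hsup.finsetSup'_mem hne fun P hP => hfin.mem_toFinset.1 hP,
    fun P hP => Finset.le_sup' id (hfin.mem_toFinset.2 hP)⟩
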